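/- A convex body is a compact convex set with non-empty interior; it is strictly convex if its boundary contains no non-degenerate segment. For a convex body $M$ in a plane $H$ and $\alpha\in(0,\pi)$, the $\alpha$-isoptic of $M$ is the set of all points of $H$ at which two support lines of $M$ intersect at the angle $\alpha$, where the angle is that of the sector containing $M$ (equivalently, the outward normals of the two support lines form the angle $\pi-\alpha$). An isoptic curve of $M$ is the $\alpha$-isoptic of $M$ for some $\alpha\in(0,\pi)$. **Theorem.** Let $K\subset\mathbb R^3$ be a strictly convex body contained in the open ball bounded by a sphere $\mathcal S$. Suppose that for every $2$-dimensional plane $H$ that meets the interior of $K$ there is an angle $\alpha_H\in(0,\pi)$, which may depend on $H$, such that $H\cap\mathcal S$ is the $\alpha_H$-isoptic of $H\cap K$ in $H$. Then $K$ is a ball concentric with $\mathcal S$. -/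

import Mathlib

/-- A strictly convex body: a compact strictly convex set with non-empty interior. -/
structure IsStrictlyConvexBody {V : Type*} [NormedAddCommGroup V] [InnerProductSpace ℝ V]
    (K : Set V) : Prop where
  isCompact : IsCompact K
  strictConvex : StrictConvex ℝ K
  interior_nonempty : (interior K).Nonempty

/-- For a set `M` in the plane `H` and a point `x` of `H`: the vector `u` is a unit vector parallel
to `H`, and the line of `H` through `x` orthogonal to `u` is the support line of `M` with outward
normal `u`, that is, `⟪u, x⟫ = max_{y ∈ M} ⟪u, y⟫`. -/
def IsSupportNormalThrough {V : Type*} [NormedAddCommGroup V] [InnerProductSpace ℝ V]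
    (H : AffineSubspace ℝ V) (M : Set V) (x u : V) : Prop :=
  u ∈ H.direction ∧ ‖u‖ = 1 ∧ IsGreatest ((fun y => inner ℝ u y) '' M) (inner ℝ u x)

/-- The `α`-isoptic of a planar convex body `M` in the plane `H`: the points of `H` at which two
support lines of `M` intersect at the angle `α`. The angle is the one of the sector that contains
`M`, so the outward normals of the two lines form the angle `π - α`. -/
def alphaIsoptic {V : Type*} [NormedAddCommGroup V] [InnerProductSpace ℝ V]
    (H : AffineSubspace ℝ V) (M : Set V) (α : ℝ) : Set V :=
  {x | x ∈ H ∧ ∃ u v : V, IsSupportNormalThrough H M x u ∧ IsSupportNormalThrough H M x v ∧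
    InnerProductGeometry.angle u v = Real.pi - α}

/-- `C` is an isoptic curve of the planar convex body `M` in the plane `H`: it is the `α`-isoptic
of `M` for some angle `α ∈ (0, π)`. -/
def IsIsopticCurve {V : Type*} [NormedAddCommGroup V] [InnerProductSpace ℝ V]
    (H : AffineSubspace ℝ V) (M C : Set V) : Prop :=
  ∃ α ∈ Set.Ioo 0 Real.pi, C = alphaIsoptic H M α

/-!
Fix a unit vector `u` and the point `p` of `K` at which `⟪u, ·⟫` is maximal. The proof shows that
`p - c` is parallel to `u`; a body all of whose normals pass through `c` is a ball about `c`.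

For a plane section `M` whose `α`-isoptic is a circle, let `h` be the support function of `M` about
the centre of the circle, as a function of the angle of the normal, and put `β = π - α`. If the
support line with normal `e(φ)` leaves the disk at the point `ρ e(φ + g)`, the second support line
through this point has normal `e(φ + β)` and leaves the disk at `ρ e(φ + β + (β - g))`
(`support_add_of_circle_isoptic`). Applying this twice replaces `g` by `β - (β - g) = g`, so that
`h (φ + 2 β) = h φ` (`support_rotation_invariant`). Since `0 < β < π`, some multiple `γ` of `2 β`
has `cos γ ≤ 0`, and `h γ = h 0`.

Now let the plane be orthogonal to `u` and close to `p`. By strict convexity the section is close to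
`p`, so `h` is close to `φ ↦ ⟪p - c, e(φ)⟫ = |q| cos φ`, where `q` is the component of `p - c`
orthogonal to `u` and the angle is measured from the direction of `q`. Then `h 0 = h γ` gives
`|q| ≤ |q| cos γ + o(1) ≤ o(1)`, hence `q = 0` (`support_point_sub_center`). The estimate is uniform
in the angle `α` of the plane, so how `α` varies with the plane does not matter.

Finally, `p = c + h_K(u) u` for the support function `h_K` of `K` about `c`, and `p ∈ K` gives
`h_K(u) ⟪u, v⟫ ≤ h_K(v)` for all unit vectors `u`, `v`. So `|h_K(u) - h_K(v)|` is at most a constant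
times `|u - v|²`, and `h_K` is constant on the sphere (`eq_of_sphere_quadratic`).
-/

/-! ### Planar sets for which a circle is an isoptic curve -/

/-- The support line with normal `e(φ)` cuts out a chord with end points `ρ e(φ ± g)`. The other
support line through `ρ e(φ + g)` has normal `e(φ + β)`, and its chord has the end points
`ρ e(φ + β ± (β - g))`. This is the inscribed angle theorem in terms of the support function `h`;
the two inequalities on sines say which end of its chord each point is. -/
theorem support_add_of_circle_isoptic {M : Set (ℝ × ℝ)} {h : ℝ → ℝ} {ρ β : ℝ}
    (hβ0 : 0 < β) (hβπ : β < Real.pi) (hρ : 0 < ρ)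
    (hM : ∀ z ∈ M, z.1 ^ 2 + z.2 ^ 2 < ρ ^ 2)
    (hh : ∀ φ, IsGreatest ((fun z : ℝ × ℝ => z.1 * Real.cos φ + z.2 * Real.sin φ) '' M) (h φ))
    (hint : ∃ m : ℝ × ℝ, ∃ r > 0, ∀ φ, (m.1 + r * Real.cos φ, m.2 + r * Real.sin φ) ∈ M)
    (hiso : ∀ θ, ∃ φ₁ φ₂, h φ₁ = ρ * Real.cos (θ - φ₁) ∧ h φ₂ = ρ * Real.cos (θ - φ₂) ∧
      Real.cos (φ₁ - φ₂) = Real.cos β)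
    {φ g : ℝ} (hg : h φ = ρ * Real.cos g) (hg0 : 0 < Real.sin g) :
    h (φ + β) = ρ * Real.cos (β - g) ∧ 0 < Real.sin (β - g) := by
  have hsβ : 0 < Real.sin β := Real.sin_pos_of_pos_of_lt_pi hβ0 hβπ
  have hle : ∀ ψ, ∀ z ∈ M, z.1 * Real.cos ψ + z.2 * Real.sin ψ ≤ h ψ :=
    fun ψ z hz => (hh ψ).2 ⟨z, hz, rfl⟩
  have htouch : ∀ ψ, ∃ z ∈ M, z.1 * Real.cos ψ + z.2 * Real.sin ψ = h ψ :=
    fun ψ => (hh ψ).1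
  -- a touching point lies in the open disk, hence strictly between the ends of its chord
  have hchord : ∀ ψ γ, ∀ z ∈ M, z.1 * Real.cos ψ + z.2 * Real.sin ψ = ρ * Real.cos γ →
      (-z.1 * Real.sin ψ + z.2 * Real.cos ψ) ^ 2 < (ρ * Real.sin γ) ^ 2 := by
    intro ψ γ z hz e
    have h1 := hM z hz
    have h2 : (z.1 * Real.cos ψ + z.2 * Real.sin ψ) ^ 2 +
        (-z.1 * Real.sin ψ + z.2 * Real.cos ψ) ^ 2 = z.1 ^ 2 + z.2 ^ 2 := by
      linear_combination (z.1 ^ 2 + z.2 ^ 2) * Real.sin_sq_add_cos_sq ψ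
    have h3 : (ρ * Real.cos γ) ^ 2 + (ρ * Real.sin γ) ^ 2 = ρ ^ 2 := by
      linear_combination ρ ^ 2 * Real.sin_sq_add_cos_sq γ
    rw [e] at h2
    linarith
  -- change of the direction in which a point is measured
  have hturn : ∀ (ψ δ : ℝ) (z : ℝ × ℝ), z.1 * Real.cos (ψ + δ) + z.2 * Real.sin (ψ + δ) =
      Real.cos δ * (z.1 * Real.cos ψ + z.2 * Real.sin ψ) +
        Real.sin δ * (-z.1 * Real.sin ψ + z.2 * Real.cos ψ) := by
    intro ψ δ z
    rw [Real.cos_add, Real.sin_add]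
    ring
  have hcongr : ∀ ψ χ, Real.cos ψ = Real.cos χ → Real.sin ψ = Real.sin χ → h ψ = h χ := by
    intro ψ χ hc hs
    have h1 := hh ψ
    rw [hc, hs] at h1
    exact h1.unique (hh χ)
  obtain ⟨y, hy, hyφ⟩ := htouch φ
  have hY : -y.1 * Real.sin φ + y.2 * Real.cos φ < ρ * Real.sin g :=
    lt_of_pow_lt_pow_left₀ 2 (by positivity) (hchord φ g y hy (hyφ.trans hg))
  have hsin : ∀ δ, h (φ + δ) = ρ * Real.cos (g - δ) → 0 ≤ Real.sin δ := by
    intro δ e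
    have h1 := hle (φ + δ) y hy
    rw [hturn, hyφ, hg, e, Real.cos_sub] at h1
    by_contra hneg
    push Not at hneg
    nlinarith
  have hcos : ∀ δ, h (φ + δ) = ρ * Real.cos (g - δ) → Real.sin δ = 0 → Real.cos δ = 1 := by
    intro δ e hs
    rcases Real.sin_eq_zero_iff_cos_eq.1 hs with hc | hc
    · exact hc
    · exfalso
      obtain ⟨m, r, hr, hm⟩ := hint
      have h1 := hle φ _ (hm φ)
      have h2 := hle (φ + δ) _ (hm (φ + δ))
      rw [e, Real.cos_sub, hs, hc] at h2
      simp only [Real.cos_add, Real.sin_add, hs, hc] at h2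
      rw [hg] at h1
      have h3 := Real.sin_sq_add_cos_sq φ
      nlinarith
  -- no two further support lines through the same end point
  have hthree : ∀ δ₁ δ₂, h (φ + δ₁) = ρ * Real.cos (g - δ₁) →
      h (φ + δ₂) = ρ * Real.cos (g - δ₂) → 0 < Real.sin δ₁ → 0 < Real.sin δ₂ →
      ¬ 0 < Real.sin (δ₂ - δ₁) := by
    intro δ₁ δ₂ e1 e2 hs1 hs2 hs
    obtain ⟨z, hz, hzφ⟩ := htouch (φ + δ₁)
    have h0 := hle φ z hz
    have h2 := hle (φ + δ₂) z hz
    rw [e1] at hzφ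
    rw [e2] at h2
    rw [hturn] at hzφ h2
    rw [Real.cos_sub] at hzφ h2
    rw [hg] at h0
    rw [Real.sin_sub] at hs
    have hz0 : z.1 * Real.cos φ + z.2 * Real.sin φ = ρ * Real.cos g := by
      apply le_antisymm h0
      by_contra hlt
      push Not at hlt
      nlinarith [mul_le_mul_of_nonneg_left h2 hs1.le, mul_lt_mul_of_pos_left hlt hs,
        congrArg (fun t => Real.sin δ₂ * t) hzφ]
    have hY' : -z.1 * Real.sin φ + z.2 * Real.cos φ < ρ * Real.sin g :=
      lt_of_pow_lt_pow_left₀ 2 (by positivity) (hchord φ g z hz hz0)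
    rw [hz0] at hzφ
    nlinarith
  have hnext : h (φ + β) = ρ * Real.cos (g - β) := by
    have key : ∀ δ₁ δ₂, h (φ + δ₁) = ρ * Real.cos (g - δ₁) →
        h (φ + δ₂) = ρ * Real.cos (g - δ₂) → Real.cos (δ₂ - δ₁) = Real.cos β →
        Real.sin δ₁ = 0 → h (φ + β) = ρ * Real.cos (g - β) := by
      intro δ₁ δ₂ e1 e2 hc hs
      have hc1 := hcos δ₁ e1 hs
      rw [Real.cos_sub, hs, hc1] at hc
      have hcc : Real.cos δ₂ = Real.cos β := by linarith
      have hss : Real.sin δ₂ = Real.sin β := by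
        have h1 := Real.sin_sq_add_cos_sq δ₂
        have h2 := Real.sin_sq_add_cos_sq β
        rw [← hcc] at h2
        exact (pow_left_inj₀ (hsin δ₂ e2) hsβ.le two_ne_zero).1 (by linarith)
      rw [Real.cos_sub, hcc, hss, ← Real.cos_sub] at e2
      rw [← e2]
      apply hcongr
      · rw [Real.cos_add, Real.cos_add, hcc, hss]
      · rw [Real.sin_add, Real.sin_add, hcc, hss]
    obtain ⟨φ₁, φ₂, e1, e2, hc⟩ := hiso (φ + g)
    obtain ⟨δ₁, rfl⟩ : ∃ δ, φ₁ = φ + δ := ⟨φ₁ - φ, by ring⟩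
    obtain ⟨δ₂, rfl⟩ : ∃ δ, φ₂ = φ + δ := ⟨φ₂ - φ, by ring⟩
    rw [add_sub_add_left_eq_sub] at e1 e2 hc
    have hc' : Real.cos (δ₂ - δ₁) = Real.cos β := by
      rw [← hc, ← Real.cos_neg (δ₁ - δ₂), neg_sub]
    rcases (hsin δ₁ e1).eq_or_lt' with h1 | h1
    · exact key δ₁ δ₂ e1 e2 hc' h1
    rcases (hsin δ₂ e2).eq_or_lt' with h2 | h2
    · exact key δ₂ δ₁ e2 e1 hc h2
    exfalso
    have h3 := hthree δ₁ δ₂ e1 e2 h1 h2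
    have h4 := hthree δ₂ δ₁ e2 e1 h2 h1
    rw [← neg_sub, Real.sin_neg] at h4
    have h5 : Real.sin (δ₂ - δ₁) = 0 := by linarith
    have h6 := Real.sin_sq_add_cos_sq (δ₂ - δ₁)
    have h7 := Real.sin_sq_add_cos_sq β
    rw [h5, hc'] at h6
    nlinarith
  refine ⟨by rw [hnext, ← Real.cos_neg, neg_sub], ?_⟩
  obtain ⟨z, hz, hzφ⟩ := htouch (φ + β)
  have hZ := hchord (φ + β) (g - β) z hz (hzφ.trans hnext)
  have h1 := hle φ z hz
  have h2 := hturn (φ + β) (-β) z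
  rw [add_neg_cancel_right, hzφ, hnext, Real.cos_neg, Real.sin_neg] at h2
  have h3 : Real.cos g = Real.cos β * Real.cos (g - β) - Real.sin β * Real.sin (g - β) := by
    rw [← Real.cos_add]
    ring_nf
  rw [h2, hg, h3] at h1
  have h4 : ρ * Real.sin (g - β) ≤ -z.1 * Real.sin (φ + β) + z.2 * Real.cos (φ + β) := by
    by_contra hlt
    push Not at hlt
    nlinarith
  rw [← neg_sub, Real.sin_neg]
  by_contra hneg
  push Not at hneg
  have h5 : 0 ≤ ρ * Real.sin (g - β) := mul_nonneg hρ.le (by linarith)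
  exact absurd (pow_le_pow_left₀ h5 h4 2) (not_le.2 hZ)

/-- If through every point of the circle of radius `ρ` about the origin there are two support lines
of `M` whose normals form the angle `β`, then the support function of `M` is invariant under the
rotation by `2 β`. -/
theorem support_rotation_invariant {M : Set (ℝ × ℝ)} {h : ℝ → ℝ} {ρ β : ℝ}
    (hβ0 : 0 < β) (hβπ : β < Real.pi) (hρ : 0 < ρ)
    (hM : ∀ z ∈ M, z.1 ^ 2 + z.2 ^ 2 < ρ ^ 2)
    (hh : ∀ φ, IsGreatest ((fun z : ℝ × ℝ => z.1 * Real.cos φ + z.2 * Real.sin φ) '' M) (h φ))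
    (hint : ∃ m : ℝ × ℝ, ∃ r > 0, ∀ φ, (m.1 + r * Real.cos φ, m.2 + r * Real.sin φ) ∈ M)
    (hiso : ∀ θ, ∃ φ₁ φ₂, h φ₁ = ρ * Real.cos (θ - φ₁) ∧ h φ₂ = ρ * Real.cos (θ - φ₂) ∧
      Real.cos (φ₁ - φ₂) = Real.cos β) (φ : ℝ) :
    h (φ + 2 * β) = h φ := by
  obtain ⟨y, hy, hyφ⟩ := (hh φ).1
  dsimp only at hyφ
  have hlt : h φ ^ 2 < ρ ^ 2 := by
    have h2 : (y.1 * Real.cos φ + y.2 * Real.sin φ) ^ 2 +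
        (-y.1 * Real.sin φ + y.2 * Real.cos φ) ^ 2 = y.1 ^ 2 + y.2 ^ 2 := by
      linear_combination (y.1 ^ 2 + y.2 ^ 2) * Real.sin_sq_add_cos_sq φ
    rw [hyφ] at h2
    nlinarith [hM y hy, sq_nonneg (-y.1 * Real.sin φ + y.2 * Real.cos φ)]
  have habs := abs_lt.1 (abs_lt_of_sq_lt_sq hlt hρ.le)
  have h1 : -1 < h φ / ρ := by rw [lt_div_iff₀ hρ]; linarith
  have h2 : h φ / ρ < 1 := by rw [div_lt_iff₀ hρ]; linarith
  have hg : h φ = ρ * Real.cos (Real.arccos (h φ / ρ)) := by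
    rw [Real.cos_arccos h1.le h2.le]
    field_simp
  have hg0 : 0 < Real.sin (Real.arccos (h φ / ρ)) := by
    rw [Real.sin_arccos, Real.sqrt_pos]
    nlinarith
  obtain ⟨e1, p1⟩ := support_add_of_circle_isoptic hβ0 hβπ hρ hM hh hint hiso hg hg0
  obtain ⟨e2, -⟩ := support_add_of_circle_isoptic hβ0 hβπ hρ hM hh hint hiso e1 p1
  rw [sub_sub_cancel, ← hg, add_assoc, ← two_mul] at e2
  exact e2

theorem exists_nat_cos_mul_nonpos {β : ℝ} (hβ0 : 0 < β) (hβπ : β < Real.pi) :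
    ∃ k : ℕ, Real.cos (k * (2 * β)) ≤ 0 := by
  -- it suffices to treat rotations by at most a half turn
  have key : ∀ γ : ℝ, 0 < γ → γ ≤ Real.pi / 2 → ∃ k : ℕ, Real.cos (k * (2 * γ)) ≤ 0 := by
    intro γ h0 h1
    refine ⟨⌈Real.pi / 2 / (2 * γ)⌉₊, Real.cos_nonpos_of_pi_div_two_le_of_le ?_ ?_⟩
    · exact (div_le_iff₀ (by positivity)).1 (Nat.le_ceil _)
    · have h2 := Nat.ceil_lt_add_one (a := Real.pi / 2 / (2 * γ)) (by positivity)
      have h3 := mul_lt_mul_of_pos_right h2 (show 0 < 2 * γ by positivity)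
      rw [add_mul, div_mul_cancel₀ _ (by positivity)] at h3
      linarith
  rcases le_or_gt β (Real.pi / 2) with h | h
  · exact key β hβ0 h
  · obtain ⟨k, hk⟩ := key (Real.pi - β) (by linarith) (by linarith)
    refine ⟨k, ?_⟩
    rwa [show (k : ℝ) * (2 * (Real.pi - β)) = k * (2 * Real.pi) - k * (2 * β) by ring,
      Real.cos_nat_mul_two_pi_sub] at hk

/-! ### Plane sections of the body -/

theorem exists_cos_sin_eq {a b : ℝ} (hab : a ^ 2 + b ^ 2 = 1) :
    ∃ φ : ℝ, a = Real.cos φ ∧ b = Real.sin φ := by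
  have hn : ‖(⟨a, b⟩ : ℂ)‖ = 1 := by
    have h := Complex.sq_norm (⟨a, b⟩ : ℂ)
    rw [Complex.normSq_mk, ← sq, ← sq, hab] at h
    exact (pow_eq_one_iff_of_nonneg (norm_nonneg _) two_ne_zero).1 h
  have h1 := Complex.norm_mul_cos_arg (⟨a, b⟩ : ℂ)
  have h2 := Complex.norm_mul_sin_arg (⟨a, b⟩ : ℂ)
  rw [hn, one_mul] at h1 h2
  exact ⟨_, h1.symm, h2.symm⟩

/-- For the section of `K` by the plane through `m` with normal `b 0`, there is an angle `γ` with
`cos γ ≤ 0` such that the support function, measured from the centre of the sphere, is at least as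
large in the direction `cos γ • b 1 + sin γ • b 2` as in the direction `b 1`. The point `y` is a
touching point for the former. -/
theorem exists_section_support_le {K : Set (EuclideanSpace ℝ (Fin 3))}
    {c m : EuclideanSpace ℝ (Fin 3)} {R : ℝ} (hK : IsCompact K) (hKS : K ⊆ Metric.ball c R)
    (hm : m ∈ interior K) (b : OrthonormalBasis (Fin 3) ℝ (EuclideanSpace ℝ (Fin 3)))
    {H : AffineSubspace ℝ (EuclideanSpace ℝ (Fin 3))}
    (hH : H = AffineSubspace.mk' m (ℝ ∙ b 0)ᗮ)
    (hiso : IsIsopticCurve H ((H : Set (EuclideanSpace ℝ (Fin 3))) ∩ K)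
        ((H : Set (EuclideanSpace ℝ (Fin 3))) ∩ Metric.sphere c R)) :
    ∃ γ : ℝ, Real.cos γ ≤ 0 ∧ ∃ y ∈ K, inner ℝ (b 0) (y - m) = 0 ∧
      ∀ z ∈ K, inner ℝ (b 0) (z - m) = 0 →
        inner ℝ (b 1) (z - c) ≤
          inner ℝ (b 1) (y - c) * Real.cos γ + inner ℝ (b 2) (y - c) * Real.sin γ := by
  have hmem : ∀ x, x ∈ H ↔ inner ℝ (b 0) (x - m) = 0 := by
    intro x
    rw [hH, AffineSubspace.mem_mk', vsub_eq_sub, Submodule.mem_orthogonal_singleton_iff_inner_right]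
  have hb00 : inner ℝ (b 0) (b 0) = (1 : ℝ) := b.inner_eq_one 0
  have hb11 : inner ℝ (b 1) (b 1) = (1 : ℝ) := b.inner_eq_one 1
  have hb22 : inner ℝ (b 2) (b 2) = (1 : ℝ) := b.inner_eq_one 2
  have hb01 : inner ℝ (b 0) (b 1) = (0 : ℝ) := b.inner_eq_zero (by decide)
  have hb02 : inner ℝ (b 0) (b 2) = (0 : ℝ) := b.inner_eq_zero (by decide)
  have hb10 : inner ℝ (b 1) (b 0) = (0 : ℝ) := b.inner_eq_zero (by decide)
  have hb12 : inner ℝ (b 1) (b 2) = (0 : ℝ) := b.inner_eq_zero (by decide)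
  have hb20 : inner ℝ (b 2) (b 0) = (0 : ℝ) := b.inner_eq_zero (by decide)
  have hb21 : inner ℝ (b 2) (b 1) = (0 : ℝ) := b.inner_eq_zero (by decide)
  set τ : ℝ := inner ℝ (b 0) (m - c) with hτ
  have hmem' : ∀ x, x ∈ H ↔ inner ℝ (b 0) (x - c) = τ := by
    intro x
    rw [hmem, hτ, ← sub_eq_zero (a := inner ℝ (b 0) (x - c)), ← inner_sub_right,
      sub_sub_sub_cancel_right]
  -- Cartesian coordinates in the plane, with origin at the centre of the circle
  let P : ℝ × ℝ → EuclideanSpace ℝ (Fin 3) := fun z => c + (τ • b 0 + z.1 • b 1 + z.2 • b 2)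
  have hP0 : ∀ z, inner ℝ (b 0) (P z - c) = τ := by
    intro z
    simp only [P, add_sub_cancel_left, inner_add_right, inner_smul_right, hb00, hb01, hb02]
    ring
  have hP1 : ∀ z, inner ℝ (b 1) (P z - c) = z.1 := by
    intro z
    simp only [P, add_sub_cancel_left, inner_add_right, inner_smul_right, hb10, hb11, hb12]
    ring
  have hP2 : ∀ z, inner ℝ (b 2) (P z - c) = z.2 := by
    intro z
    simp only [P, add_sub_cancel_left, inner_add_right, inner_smul_right, hb20, hb21, hb22]
    ring
  have hPH : ∀ z, P z ∈ H := fun z => (hmem' _).2 (hP0 z)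
  have hcoord : ∀ x ∈ H, P (inner ℝ (b 1) (x - c), inner ℝ (b 2) (x - c)) = x := by
    intro x hx
    have h1 := b.sum_repr' (x - c)
    rw [Fin.sum_univ_three, (hmem' x).1 hx] at h1
    simp only [P, h1, add_sub_cancel]
  have hPn : ∀ z, ‖P z - c‖ ^ 2 = τ ^ 2 + (z.1 ^ 2 + z.2 ^ 2) := by
    intro z
    have h1 := b.sum_sq_norm_inner_right (P z - c)
    rw [Fin.sum_univ_three, hP0, hP1, hP2] at h1
    simp only [Real.norm_eq_abs, sq_abs] at h1
    linarith
  have hmH : m ∈ H := by rw [hmem]; simp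
  have hmK : m ∈ K := interior_subset hm
  have hlt : ∀ z, P z ∈ K → τ ^ 2 + (z.1 ^ 2 + z.2 ^ 2) < R ^ 2 := by
    intro z hz
    rw [← hPn]
    have h1 := hKS hz
    rw [Metric.mem_ball, dist_eq_norm] at h1
    exact pow_lt_pow_left₀ h1 (norm_nonneg _) two_ne_zero
  have hR : 0 < R := Metric.pos_of_mem_ball (hKS hmK)
  set ρ : ℝ := Real.sqrt (R ^ 2 - τ ^ 2) with hρdef
  have hpos : 0 < R ^ 2 - τ ^ 2 := by
    have h1 := hlt _ ((hcoord m hmH).symm ▸ hmK)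
    nlinarith [sq_nonneg (inner ℝ (b 1) (m - c) : ℝ), sq_nonneg (inner ℝ (b 2) (m - c) : ℝ)]
  have hρ : 0 < ρ := Real.sqrt_pos.2 hpos
  have hρ2 : ρ ^ 2 = R ^ 2 - τ ^ 2 := Real.sq_sqrt hpos.le
  have hcomp : IsCompact (K ∩ {x | inner ℝ (b 0) (x - c) = τ}) :=
    hK.inter_right (isClosed_eq (by fun_prop) continuous_const)
  have hmax : ∀ φ : ℝ, ∃ y ∈ K ∩ {x | inner ℝ (b 0) (x - c) = τ},
      IsMaxOn (fun x => inner ℝ (b 1) (x - c) * Real.cos φ + inner ℝ (b 2) (x - c) * Real.sin φ)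
        (K ∩ {x | inner ℝ (b 0) (x - c) = τ}) y :=
    fun φ => hcomp.exists_isMaxOn ⟨m, hmK, rfl⟩ (by fun_prop)
  choose y hy hymax using hmax
  have hyK : ∀ φ, y φ ∈ K := fun φ => (hy φ).1
  have hyH : ∀ φ, y φ ∈ H := fun φ => (hmem' _).2 (hy φ).2
  let h : ℝ → ℝ := fun φ =>
    inner ℝ (b 1) (y φ - c) * Real.cos φ + inner ℝ (b 2) (y φ - c) * Real.sin φ
  have hle : ∀ φ, ∀ x ∈ K, x ∈ H →
      inner ℝ (b 1) (x - c) * Real.cos φ + inner ℝ (b 2) (x - c) * Real.sin φ ≤ h φ :=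
    fun φ x hx hxH => hymax φ ⟨hx, (hmem' x).1 hxH⟩
  have hgreat : ∀ φ, IsGreatest
      ((fun z : ℝ × ℝ => z.1 * Real.cos φ + z.2 * Real.sin φ) '' (P ⁻¹' K)) (h φ) := by
    intro φ
    refine ⟨⟨(inner ℝ (b 1) (y φ - c), inner ℝ (b 2) (y φ - c)), ?_, rfl⟩, ?_⟩
    · rw [Set.mem_preimage, hcoord _ (hyH φ)]
      exact hyK φ
    · rintro _ ⟨z, hz, rfl⟩
      have h1 := hle φ (P z) hz (hPH z)
      rwa [hP1, hP2] at h1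
  have hint : ∃ z : ℝ × ℝ, ∃ r > 0, ∀ φ,
      (z.1 + r * Real.cos φ, z.2 + r * Real.sin φ) ∈ P ⁻¹' K := by
    obtain ⟨δ, hδ, hball⟩ := Metric.isOpen_iff.1 isOpen_interior m hm
    refine ⟨(inner ℝ (b 1) (m - c), inner ℝ (b 2) (m - c)), δ / 2, half_pos hδ, fun φ => ?_⟩
    change P _ ∈ K
    refine interior_subset (hball ?_)
    have h0 := hcoord m hmH
    have h1 : P (inner ℝ (b 1) (m - c) + δ / 2 * Real.cos φ,
        inner ℝ (b 2) (m - c) + δ / 2 * Real.sin φ) - m =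
        (δ / 2) • (Real.cos φ • b 1 + Real.sin φ • b 2) := by
      nth_rewrite 3 [← h0]
      simp only [P]
      module
    have h2 : ‖Real.cos φ • b 1 + Real.sin φ • b 2‖ ^ 2 = 1 := by
      rw [← real_inner_self_eq_norm_sq]
      simp only [inner_add_right, inner_add_left, inner_smul_right, real_inner_smul_left, hb11,
        hb12, hb21, hb22]
      linear_combination Real.sin_sq_add_cos_sq φ
    rw [Metric.mem_ball, dist_eq_norm, h1, norm_smul,
      (pow_eq_one_iff_of_nonneg (norm_nonneg _) two_ne_zero).1 h2,
      Real.norm_of_nonneg (by positivity)]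
    linarith
  obtain ⟨α, ⟨hα0, hαπ⟩, hset⟩ := hiso
  have hnormal : ∀ x ∈ H, ∀ u, IsSupportNormalThrough H ((H : Set _) ∩ K) x u →
      ∃ φ, u = Real.cos φ • b 1 + Real.sin φ • b 2 ∧
        h φ = inner ℝ (b 1) (x - c) * Real.cos φ + inner ℝ (b 2) (x - c) * Real.sin φ := by
    rintro x hxH u ⟨hu, hu1, ⟨w, ⟨hwH, hwK⟩, hw⟩, hub⟩
    rw [hH, AffineSubspace.direction_mk', Submodule.mem_orthogonal_singleton_iff_inner_right] at hu
    have hsum := b.sum_repr' u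
    have hnorm := b.sum_sq_norm_inner_right u
    rw [Fin.sum_univ_three, hu, hu1] at hnorm
    rw [Fin.sum_univ_three, hu, zero_smul, zero_add] at hsum
    simp only [Real.norm_eq_abs, sq_abs] at hnorm
    obtain ⟨φ, h1, h2⟩ := exists_cos_sin_eq (a := inner ℝ (b 1) u) (b := inner ℝ (b 2) u)
      (by linarith)
    rw [h1, h2] at hsum
    have hval : ∀ x, inner ℝ u x - inner ℝ u c =
        inner ℝ (b 1) (x - c) * Real.cos φ + inner ℝ (b 2) (x - c) * Real.sin φ := by
      intro x
      rw [← inner_sub_right, ← hsum, inner_add_left, real_inner_smul_left, real_inner_smul_left]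
      ring
    refine ⟨φ, hsum.symm, le_antisymm ?_ ?_⟩
    · have h3 : inner ℝ u (y φ) ≤ inner ℝ u x := hub ⟨y φ, ⟨hyH φ, hyK φ⟩, rfl⟩
      rw [← hval]
      change inner ℝ (b 1) (y φ - c) * Real.cos φ + inner ℝ (b 2) (y φ - c) * Real.sin φ ≤ _
      rw [← hval]
      linarith
    · have h3 := hle φ w hwK hwH
      dsimp only at hw
      rw [← hval] at h3 ⊢
      linarith
  have hcirc : ∀ θ, ∃ φ₁ φ₂, h φ₁ = ρ * Real.cos (θ - φ₁) ∧ h φ₂ = ρ * Real.cos (θ - φ₂) ∧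
      Real.cos (φ₁ - φ₂) = Real.cos (Real.pi - α) := by
    intro θ
    have hx : P (ρ * Real.cos θ, ρ * Real.sin θ) ∈
        (H : Set (EuclideanSpace ℝ (Fin 3))) ∩ Metric.sphere c R := by
      refine ⟨hPH _, ?_⟩
      rw [Metric.mem_sphere, dist_eq_norm]
      apply (pow_left_inj₀ (norm_nonneg _) hR.le two_ne_zero).1
      rw [hPn]
      linear_combination ρ ^ 2 * Real.sin_sq_add_cos_sq θ + hρ2
    rw [hset] at hx
    obtain ⟨hxH, u, v, hu, hv, hang⟩ := hx
    obtain ⟨φ₁, hu', h1⟩ := hnormal _ hxH u hu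
    obtain ⟨φ₂, hv', h2⟩ := hnormal _ hxH v hv
    rw [hP1, hP2] at h1 h2
    refine ⟨φ₁, φ₂, by rw [h1, Real.cos_sub]; ring, by rw [h2, Real.cos_sub]; ring, ?_⟩
    rw [← hang, InnerProductGeometry.cos_angle, hu.2.1, hv.2.1, hu', hv', Real.cos_sub]
    simp only [inner_add_right, inner_add_left, inner_smul_right, real_inner_smul_left, hb11,
      hb12, hb21, hb22]
    ring
  have hrot := support_rotation_invariant (β := Real.pi - α) (by linarith) (by linarith) hρ
    (fun z hz => by have := hlt z hz; linarith) hgreat hint hcirc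
  obtain ⟨k, hk⟩ := exists_nat_cos_mul_nonpos (β := Real.pi - α) (by linarith) (by linarith)
  have hiter : ∀ n : ℕ, h (n * (2 * (Real.pi - α))) = h 0 := by
    intro n
    induction n with
    | zero => simp
    | succ n ih => rw [Nat.cast_succ, add_one_mul, hrot, ih]
  set γ : ℝ := k * (2 * (Real.pi - α))
  refine ⟨γ, hk, y γ, hyK γ, (hmem (y γ)).1 (hyH γ), fun z hz hz0 => ?_⟩
  have h1 := hle 0 z hz ((hmem z).2 hz0)
  have h2 : h γ = h 0 := hiter k
  rw [← h2, Real.cos_zero, Real.sin_zero, mul_one, mul_zero, add_zero] at h1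
  exact h1

/-! ### Support points -/

/-- Close to a support plane, a strictly convex body is close to the support point. -/
theorem exists_interior_section_near {V : Type*} [NormedAddCommGroup V] [InnerProductSpace ℝ V]
    {K : Set V} (hK : IsStrictlyConvexBody K) {u p : V} (hu : u ≠ 0) (hp : p ∈ K)
    (hmax : ∀ y ∈ K, inner ℝ u y ≤ inner ℝ u p) {η : ℝ} (hη : 0 < η) :
    ∃ m ∈ interior K, ∀ y ∈ K, inner ℝ u (y - m) = 0 → ‖y - p‖ < η := by
  have huniq : ∀ y ∈ K, inner ℝ u y = inner ℝ u p → y = p := by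
    intro y hy hyp
    by_contra hne
    have hmid : y + (1 / 2 : ℝ) • (p - y) ∈ interior K :=
      hK.strictConvex.add_smul_sub_mem hy hp hne (by norm_num) (by norm_num)
    obtain ⟨δ, hδ, hball⟩ := Metric.isOpen_iff.1 isOpen_interior _ hmid
    have hun : 0 < ‖u‖ := norm_pos_iff.2 hu
    have h1 : y + (1 / 2 : ℝ) • (p - y) + (δ / 2 / ‖u‖) • u ∈ K := by
      refine interior_subset (hball ?_)
      rw [Metric.mem_ball, dist_eq_norm, add_sub_cancel_left, norm_smul,
        Real.norm_of_nonneg (by positivity), div_mul_cancel₀ _ hun.ne']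
      linarith
    have h2 := hmax _ h1
    rw [inner_add_right, inner_add_right, inner_smul_right, inner_smul_right, inner_sub_right,
      hyp, real_inner_self_eq_norm_sq] at h2
    have h3 : 0 < δ / 2 / ‖u‖ * ‖u‖ ^ 2 := by positivity
    linarith
  obtain ⟨m₀, hm₀⟩ := hK.interior_nonempty
  have hm₀K := interior_subset hm₀
  -- the points of `K` far from `p` stay below a lower level
  obtain ⟨s, hs, hfar⟩ : ∃ s < inner ℝ u p, ∀ y ∈ K, η ≤ ‖y - p‖ → inner ℝ u y ≤ s := by
    have hcomp : IsCompact (K ∩ {y | η ≤ ‖y - p‖}) :=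
      hK.isCompact.inter_right (isClosed_le continuous_const (by fun_prop))
    rcases (K ∩ {y | η ≤ ‖y - p‖}).eq_empty_or_nonempty with he | hne
    · refine ⟨inner ℝ u p - 1, by linarith, fun y hy hyη => ?_⟩
      exact absurd (show y ∈ K ∩ {y | η ≤ ‖y - p‖} from ⟨hy, hyη⟩) (he ▸ Set.notMem_empty y)
    · obtain ⟨z, ⟨hzK, hzη⟩, hz⟩ := hcomp.exists_isMaxOn hne
        (f := fun y => (inner ℝ u y : ℝ)) (by fun_prop)
      refine ⟨inner ℝ u z, lt_of_le_of_ne (hmax z hzK) fun h => ?_, fun y hy hyη => hz ⟨hy, hyη⟩⟩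
      rw [huniq z hzK h, Set.mem_ofPred_eq, sub_self, norm_zero] at hzη
      exact absurd hzη (not_le.2 hη)
  have hD : 0 ≤ inner ℝ u p - inner ℝ u m₀ := sub_nonneg.2 (hmax m₀ hm₀K)
  set D : ℝ := inner ℝ u p - inner ℝ u m₀ with hDdef
  have hq : 0 < inner ℝ u p - s := sub_pos.2 hs
  set q : ℝ := inner ℝ u p - s with hqdef
  have ht0 : 0 < q / (D + q) := by positivity
  have ht1 : q / (D + q) ≤ 1 := (div_le_one (by positivity)).2 (by linarith)
  refine ⟨p + (q / (D + q)) • (m₀ - p),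
    hK.strictConvex.convex.add_smul_sub_mem_interior hp hm₀ ⟨ht0, ht1⟩, fun y hy hy0 => ?_⟩
  by_contra hfar'
  have h1 := hfar y hy (not_lt.1 hfar')
  rw [inner_sub_right, inner_add_right, inner_smul_right, inner_sub_right] at hy0
  have h2 : q / (D + q) * D < q := by
    rw [div_mul_eq_mul_div, div_lt_iff₀ (by positivity)]
    nlinarith
  have h3 : inner ℝ u y = inner ℝ u p - q / (D + q) * D := by
    rw [hDdef]
    linarith
  linarith

theorem exists_orthonormalBasis_zero_one {u e : EuclideanSpace ℝ (Fin 3)} (hu : ‖u‖ = 1)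
    (he : ‖e‖ = 1) (hue : inner ℝ u e = 0) :
    ∃ b : OrthonormalBasis (Fin 3) ℝ (EuclideanSpace ℝ (Fin 3)), b 0 = u ∧ b 1 = e := by
  have hon : Orthonormal ℝ (({0, 1} : Set (Fin 3)).domRestrict ![u, e, 0]) := by
    constructor
    · rintro ⟨i, rfl | rfl⟩
      · simpa using hu
      · simpa using he
    · rintro ⟨i, rfl | rfl⟩ ⟨j, rfl | rfl⟩ hij
      · exact absurd rfl hij
      · simpa using hue
      · simpa [real_inner_comm] using hue
      · exact absurd rfl hij
  obtain ⟨b, hb⟩ := hon.exists_orthonormalBasis_extension_of_card_eq (by simp)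
  exact ⟨b, hb 0 (by simp), hb 1 (by simp)⟩

/-- Every normal of the body passes through the centre of the sphere. The component of `p - c`
orthogonal to `u` is compared with the rotation invariance of the sections close to `p`. -/
theorem support_point_sub_center {K : Set (EuclideanSpace ℝ (Fin 3))}
    {c : EuclideanSpace ℝ (Fin 3)} {R : ℝ} (hK : IsStrictlyConvexBody K)
    (hKS : K ⊆ Metric.ball c R)
    (hiso : ∀ H : AffineSubspace ℝ (EuclideanSpace ℝ (Fin 3)),
      Module.finrank ℝ H.direction = 2 →
      ((H : Set (EuclideanSpace ℝ (Fin 3))) ∩ interior K).Nonempty →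
      IsIsopticCurve H ((H : Set (EuclideanSpace ℝ (Fin 3))) ∩ K)
        ((H : Set (EuclideanSpace ℝ (Fin 3))) ∩ Metric.sphere c R))
    {u p : EuclideanSpace ℝ (Fin 3)} (hu : ‖u‖ = 1) (hp : p ∈ K)
    (hmax : ∀ y ∈ K, inner ℝ u y ≤ inner ℝ u p) :
    p - c = (inner ℝ u (p - c) : ℝ) • u := by
  by_contra hne
  set q := p - c - (inner ℝ u (p - c) : ℝ) • u with hq
  have hq0 : q ≠ 0 := sub_ne_zero.2 hne
  have hqn : 0 < ‖q‖ := norm_pos_iff.2 hq0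
  have huq : inner ℝ u q = 0 := by
    rw [hq, inner_sub_right, inner_smul_right, real_inner_self_eq_norm_sq, hu]
    ring
  obtain ⟨b, hb0, hb1⟩ := exists_orthonormalBasis_zero_one (e := ‖q‖⁻¹ • q) hu
    (by rw [norm_smul, norm_inv, norm_norm, inv_mul_cancel₀ hqn.ne'])
    (by rw [inner_smul_right, huq, mul_zero])
  have hpc : p - c = (inner ℝ u (p - c) : ℝ) • b 0 + ‖q‖ • b 1 := by
    rw [hb0, hb1, smul_inv_smul₀ hqn.ne', hq]
    abel
  have hp1 : inner ℝ (b 1) (p - c) = ‖q‖ := by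
    rw [hpc, inner_add_right, inner_smul_right, inner_smul_right, b.inner_eq_one,
      b.inner_eq_zero (show (1 : Fin 3) ≠ 0 by decide)]
    ring
  have hp2 : inner ℝ (b 2) (p - c) = (0 : ℝ) := by
    rw [hpc, inner_add_right, inner_smul_right, inner_smul_right,
      b.inner_eq_zero (show (2 : Fin 3) ≠ 0 by decide),
      b.inner_eq_zero (show (2 : Fin 3) ≠ 1 by decide)]
    ring
  have hu0 : u ≠ 0 := norm_ne_zero_iff.1 (by rw [hu]; exact one_ne_zero)
  obtain ⟨m, hm, hnear⟩ := exists_interior_section_near hK hu0 hp hmax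
    (η := ‖q‖ / 3) (by positivity)
  have hdim : Module.finrank ℝ (AffineSubspace.mk' m (ℝ ∙ b 0)ᗮ).direction = 2 := by
    have : Fact (Module.finrank ℝ (EuclideanSpace ℝ (Fin 3)) = 2 + 1) := ⟨by simp⟩
    rw [AffineSubspace.direction_mk']
    exact Submodule.finrank_orthogonal_span_singleton (hb0 ▸ hu0)
  obtain ⟨γ, hγ, y, hy, hy0, hle⟩ := exists_section_support_le hK.isCompact hKS hm b rfl
    (hiso _ hdim ⟨m, AffineSubspace.self_mem_mk' _ _, hm⟩)
  have hyp := hnear y hy (hb0 ▸ hy0)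
  have h1 := hle m (interior_subset hm) (by simp)
  have hmp := hnear m (interior_subset hm) (by simp)
  have h2 : |inner ℝ (b 1) (m - p)| ≤ ‖m - p‖ := by
    simpa using abs_real_inner_le_norm (b 1) (m - p)
  have h3 : |inner ℝ (Real.cos γ • b 1 + Real.sin γ • b 2) (y - p)| ≤ ‖y - p‖ := by
    have hn : ‖Real.cos γ • b 1 + Real.sin γ • b 2‖ ^ 2 = 1 := by
      rw [← real_inner_self_eq_norm_sq]
      simp only [inner_add_right, inner_add_left, inner_smul_right, real_inner_smul_left,
        b.inner_eq_one, b.inner_eq_zero (show (1 : Fin 3) ≠ 2 by decide),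
        b.inner_eq_zero (show (2 : Fin 3) ≠ 1 by decide)]
      linear_combination Real.sin_sq_add_cos_sq γ
    have h := abs_real_inner_le_norm (Real.cos γ • b 1 + Real.sin γ • b 2) (y - p)
    rwa [(pow_eq_one_iff_of_nonneg (norm_nonneg _) two_ne_zero).1 hn, one_mul] at h
  rw [inner_add_left, real_inner_smul_left, real_inner_smul_left] at h3
  rw [← sub_add_sub_cancel m p c, ← sub_add_sub_cancel y p c, inner_add_right, inner_add_right,
    inner_add_right, hp1, hp2] at h1
  have h4 := (abs_le.1 h2).1
  have h5 := (abs_le.1 h3).2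
  nlinarith

/-! ### Bodies all of whose normals pass through one point -/

/-- A quadratic modulus of continuity on the sphere forces a function to be constant. -/
theorem eq_of_sphere_quadratic {f : EuclideanSpace ℝ (Fin 3) → ℝ} {C : ℝ}
    (hf : ∀ u v, ‖u‖ = 1 → ‖v‖ = 1 → |f u - f v| ≤ C * ‖u - v‖ ^ 2)
    {u v : EuclideanSpace ℝ (Fin 3)} (hu : ‖u‖ = 1) (hv : ‖v‖ = 1) : f u = f v := by
  have hC : 0 ≤ C := by
    have h := (abs_nonneg _).trans (hf u (-u) hu (by rwa [norm_neg]))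
    rw [sub_neg_eq_add, ← two_smul ℝ u, norm_smul, hu] at h
    norm_num at h
    linarith
  -- along a great circle the derivative vanishes
  have harc : ∀ e, ‖e‖ = 1 → inner ℝ u e = 0 → ∀ φ : ℝ,
      f (Real.cos φ • u + Real.sin φ • e) = f u := by
    intro e he hue φ
    have hsq : ∀ a b : ℝ, ‖a • u + b • e‖ ^ 2 = a ^ 2 + b ^ 2 := by
      intro a b
      rw [← real_inner_self_eq_norm_sq]
      simp only [inner_add_right, inner_add_left, inner_smul_right, real_inner_smul_left,
        real_inner_self_eq_norm_sq, hu, he, hue, real_inner_comm u e]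
      ring
    have hone : ∀ φ : ℝ, ‖Real.cos φ • u + Real.sin φ • e‖ = 1 := fun φ =>
      (pow_eq_one_iff_of_nonneg (norm_nonneg _) two_ne_zero).1
        (by rw [hsq, Real.cos_sq_add_sin_sq])
    have hbound : ∀ φ ψ : ℝ, |f (Real.cos φ • u + Real.sin φ • e) -
        f (Real.cos ψ • u + Real.sin ψ • e)| ≤ C * |φ - ψ| ^ 2 := by
      intro φ ψ
      refine (hf _ _ (hone φ) (hone ψ)).trans (mul_le_mul_of_nonneg_left ?_ hC)
      rw [show Real.cos φ • u + Real.sin φ • e - (Real.cos ψ • u + Real.sin ψ • e) =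
        (Real.cos φ - Real.cos ψ) • u + (Real.sin φ - Real.sin ψ) • e by module, hsq, sq_abs]
      have h1 := Real.one_sub_sq_div_two_le_cos (x := φ - ψ)
      rw [Real.cos_sub] at h1
      nlinarith [Real.sin_sq_add_cos_sq φ, Real.sin_sq_add_cos_sq ψ]
    have hderiv : ∀ ψ, HasDerivAt (fun φ : ℝ => f (Real.cos φ • u + Real.sin φ • e)) 0 ψ := by
      intro ψ
      rw [hasDerivAt_iff_isLittleO]
      simp only [smul_zero, sub_zero]
      refine Asymptotics.IsBigO.trans_isLittleO (g := fun φ => (φ - ψ) ^ 2) ?_ ?_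
      · refine Asymptotics.IsBigO.of_bound C (Filter.Eventually.of_forall fun φ => ?_)
        rw [norm_pow]
        exact hbound φ ψ
      · simpa only [Real.norm_eq_abs, sq_abs] using Asymptotics.isLittleO_pow_sub_sub ψ one_lt_two
    have h := is_const_of_deriv_eq_zero (fun ψ => (hderiv ψ).differentiableAt)
      (fun ψ => (hderiv ψ).deriv) φ 0
    simpa using h
  have hdec : ∃ e, ‖e‖ = 1 ∧ inner ℝ u e = 0 ∧ ∃ t : ℝ, v = (inner ℝ u v : ℝ) • u + t • e := by
    set w := v - (inner ℝ u v : ℝ) • u with hw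
    have huw : inner ℝ u w = 0 := by
      rw [hw, inner_sub_right, inner_smul_right, real_inner_self_eq_norm_sq, hu]
      ring
    rcases eq_or_ne w 0 with h0 | h0
    · -- `v = ± u`: any orthogonal direction will do
      have hon : Orthonormal ℝ (({0} : Set (Fin 3)).domRestrict ![u, 0, 0]) := by
        constructor
        · rintro ⟨i, rfl⟩
          simpa using hu
        · rintro ⟨i, rfl⟩ ⟨j, rfl⟩ hij
          exact absurd rfl hij
      obtain ⟨b, hb⟩ := hon.exists_orthonormalBasis_extension_of_card_eq (by simp)
      have hb0 : b 0 = u := hb 0 rfl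
      refine ⟨b 1, b.norm_eq_one 1, hb0 ▸ b.inner_eq_zero (by decide), 0, ?_⟩
      rw [zero_smul, add_zero]
      exact sub_eq_zero.1 h0
    · have hwn : ‖w‖ ≠ 0 := norm_ne_zero_iff.2 h0
      refine ⟨‖w‖⁻¹ • w, by rw [norm_smul, norm_inv, norm_norm, inv_mul_cancel₀ hwn],
        by rw [inner_smul_right, huw, mul_zero], ‖w‖, ?_⟩
      rw [smul_inv_smul₀ hwn, hw]
      abel
  obtain ⟨e, he, hue, t, ht⟩ := hdec
  have hn : (inner ℝ u v : ℝ) ^ 2 + t ^ 2 = 1 := by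
    have h1 : ‖v‖ ^ 2 = 1 := by rw [hv, one_pow]
    rw [ht, ← real_inner_self_eq_norm_sq] at h1
    simp only [inner_add_right, inner_add_left, inner_smul_right, real_inner_smul_left,
      real_inner_self_eq_norm_sq, hu, he, hue, real_inner_comm u e] at h1
    linarith
  obtain ⟨φ, h1, h2⟩ := exists_cos_sin_eq hn
  rw [h1, h2] at ht
  rw [ht, harc e he hue φ]

/-- If every support point lies on the line through `c` in the direction of its normal, then the
support function about `c` has no tangential derivative, so it is constant. -/
theorem eq_closedBall_of_support_points {K : Set (EuclideanSpace ℝ (Fin 3))}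
    {c : EuclideanSpace ℝ (Fin 3)} (hK : IsStrictlyConvexBody K)
    (hcenter : ∀ u p, ‖u‖ = 1 → p ∈ K → (∀ y ∈ K, inner ℝ u y ≤ inner ℝ u p) →
      p - c = (inner ℝ u (p - c) : ℝ) • u) :
    ∃ r : ℝ, 0 < r ∧ K = Metric.closedBall c r := by
  obtain ⟨m, hm⟩ := hK.interior_nonempty
  have hmK := interior_subset hm
  have hexists : ∀ u, ∃ p ∈ K, IsMaxOn (fun y => (inner ℝ u y : ℝ)) K p :=
    fun u => hK.isCompact.exists_isMaxOn ⟨m, hmK⟩ (by fun_prop)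
  choose p hpK hpmax using hexists
  have hmax : ∀ u, ∀ y ∈ K, inner ℝ u y ≤ inner ℝ u (p u) := fun u y hy => hpmax u hy
  let h : EuclideanSpace ℝ (Fin 3) → ℝ := fun u => inner ℝ u (p u - c)
  have hp : ∀ u, ‖u‖ = 1 → p u - c = h u • u := fun u hu => hcenter u (p u) hu (hpK u) (hmax u)
  have hle : ∀ u, ∀ y ∈ K, inner ℝ u (y - c) ≤ h u := by
    intro u y hy
    simp only [h, inner_sub_right]
    linarith [hmax u y hy]
  obtain ⟨C, hC⟩ : ∃ C, ∀ y ∈ K, ‖y - c‖ ≤ C :=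
    hK.isCompact.exists_bound_of_continuousOn (by fun_prop)
  have habs : ∀ u, ‖u‖ = 1 → |h u| ≤ C := by
    intro u hu
    have h1 := hC (p u) (hpK u)
    rwa [hp u hu, norm_smul, hu, mul_one] at h1
  have hquad : ∀ u v, ‖u‖ = 1 → ‖v‖ = 1 → |h u - h v| ≤ C / 2 * ‖u - v‖ ^ 2 := by
    have key : ∀ u v, ‖u‖ = 1 → ‖v‖ = 1 → h u - h v ≤ C / 2 * ‖u - v‖ ^ 2 := by
      intro u v hu hv
      have h1 := hle v (p u) (hpK u)
      rw [hp u hu, inner_smul_right, real_inner_comm] at h1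
      have h2 := norm_sub_sq_real u v
      rw [hu, hv] at h2
      have h3 := mul_le_mul_of_nonneg_right (abs_le.1 (habs u hu)).2 (sq_nonneg ‖u - v‖)
      rw [h2] at h3 ⊢
      linarith
    intro u v hu hv
    refine abs_le.2 ⟨?_, key u v hu hv⟩
    have h1 := key v u hv hu
    rw [norm_sub_rev] at h1
    linarith
  obtain ⟨e, he⟩ := exists_norm_eq (EuclideanSpace ℝ (Fin 3)) zero_le_one
  have hconst : ∀ u, ‖u‖ = 1 → h u = h e := fun u hu => eq_of_sphere_quadratic hquad hu he
  set r := h e with hr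
  have hnorm : ∀ y ∈ K, y ≠ c → ‖y - c‖ ≤ r := by
    intro y hy hyc
    have hn : ‖y - c‖ ≠ 0 := norm_ne_zero_iff.2 (sub_ne_zero.2 hyc)
    have h1 := hle (‖y - c‖⁻¹ • (y - c)) y hy
    rw [hconst _ (by rw [norm_smul, norm_inv, norm_norm, inv_mul_cancel₀ hn]),
      real_inner_smul_left, real_inner_self_eq_norm_sq, sq, inv_mul_cancel_left₀ hn] at h1
    exact h1
  have hrpos : 0 < r := by
    obtain ⟨y, hy, hyc⟩ : ∃ y ∈ K, y ≠ c := by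
      by_contra! hall
      obtain ⟨δ, hδ, hball⟩ := Metric.isOpen_iff.1 isOpen_interior m hm
      have h1 : m + (δ / 2) • e ∈ K := by
        refine interior_subset (hball ?_)
        rw [Metric.mem_ball, dist_eq_norm, add_sub_cancel_left, norm_smul, he,
          Real.norm_of_nonneg (by positivity)]
        linarith
      have h2 := hall _ h1
      rw [hall m hmK, add_eq_left, smul_eq_zero] at h2
      rcases h2 with h2 | h2
      · linarith
      · rw [h2, norm_zero] at he
        exact zero_ne_one he
    exact (norm_pos_iff.2 (sub_ne_zero.2 hyc)).trans_le (hnorm y hy hyc)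
  have hmem : ∀ u, ‖u‖ = 1 → c + r • u ∈ K := by
    intro u hu
    rw [← hconst u hu, ← hp u hu, add_sub_cancel]
    exact hpK u
  -- each point of the ball lies on a diameter whose ends are support points
  have hdiam : ∀ u, ‖u‖ = 1 → ∀ s : ℝ, 0 ≤ s → s ≤ r → c + s • u ∈ K := by
    intro u hu s hs0 hsr
    have h1 := hK.strictConvex.convex (hmem u hu) (hmem (-u) (by rwa [norm_neg]))
      (a := (1 + s / r) / 2) (b := (1 - s / r) / 2) (by positivity)
      (by have := (div_le_one hrpos).2 hsr; linarith) (by ring)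
    convert h1 using 1
    match_scalars
    · ring
    · field_simp
      ring
  refine ⟨r, hrpos, Set.Subset.antisymm (fun y hy => ?_) (fun y hy => ?_)⟩
  · rw [Metric.mem_closedBall, dist_eq_norm]
    rcases eq_or_ne y c with rfl | hyc
    · simpa using hrpos.le
    · exact hnorm y hy hyc
  · rw [Metric.mem_closedBall, dist_eq_norm] at hy
    rcases eq_or_ne y c with rfl | hyc
    · simpa using hdiam e he 0 le_rfl hrpos.le
    · have hn : ‖y - c‖ ≠ 0 := norm_ne_zero_iff.2 (sub_ne_zero.2 hyc)
      have h1 := hdiam (‖y - c‖⁻¹ • (y - c))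
        (by rw [norm_smul, norm_inv, norm_norm, inv_mul_cancel₀ hn]) ‖y - c‖ (norm_nonneg _) hy
      rwa [smul_inv_smul₀ hn, add_sub_cancel] at h1

theorem mainTheorem7 (K : Set (EuclideanSpace ℝ (Fin 3))) (c : EuclideanSpace ℝ (Fin 3)) (R : ℝ)
    (hK : IsStrictlyConvexBody K) (hKS : K ⊆ Metric.ball c R)
    (hiso : ∀ H : AffineSubspace ℝ (EuclideanSpace ℝ (Fin 3)),
      Module.finrank ℝ H.direction = 2 →
      ((H : Set (EuclideanSpace ℝ (Fin 3))) ∩ interior K).Nonempty →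
      IsIsopticCurve H ((H : Set (EuclideanSpace ℝ (Fin 3))) ∩ K)
        ((H : Set (EuclideanSpace ℝ (Fin 3))) ∩ Metric.sphere c R)) :
    ∃ r : ℝ, 0 < r ∧ K = Metric.closedBall c r :=
  eq_closedBall_of_support_points hK fun _ _ hu hp hmax =>
    support_point_sub_center hK hKS hiso hu hp hmax
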